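/- Let $p$ be a prime number. A $\delta$-ring is a commutative ring $A$ together with a map $\delta : A \to A$ such that $\delta(1) = 0$ and, for all $x, y \in A$, \[ \delta(xy) = x^p\delta(y) + \delta(x)y^p + p\,\delta(x)\delta(y), \qquad \delta(x+y) = \delta(x) + \delta(y) + \frac{x^p + y^p - (x+y)^p}{p}, \] where the last fraction denotes the value at $(x,y)$ of the corresponding polynomial with integer coefficients. Its Frobenius lift is the ring homomorphism $\varphi : A \to A$, $\varphi(x) = x^p + p\,\delta(x)$. An isomorphism of $\delta$-rings is a ring isomorphism that commutes with $\delta$. A $p$-Boolean algebra is an $\mathbb{F}_p$-algebra $R$ with $a^p = a$ for all $a \in R$. For a perfect $\mathbb{F}_p$-algebra $R$ (in particular, for a $p$-Boolean algebra), the ring $W(R)$ of $p$-typical Witt vectors carries its canonical $\delta$-structure, the unique one whose Frobenius lift is the Witt vector Frobenius. A $\delta$-ring is called a Stone $\delta$-ring if it is isomorphic, as a $\delta$-ring, to $W(R)$ for some $p$-Boolean algebra $R$. Proposition. Let $A$ be a $\delta$-ring that is (classically) $p$-adically complete and separated. Then $A$ is a Stone $\delta$-ring if and only if its Frobenius lift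 $\varphi$ is the identity map of $A$. -/

import Mathlib

universe u

/-- A `δ`-ring structure, relative to `p`, on a commutative ring `A`. In the sum formula, the term
`(x ^ p + y ^ p - (x + y) ^ p) / p` is the value of the polynomial with integer coefficients
`-∑_{0 < i < p} ((p choose i) / p) X ^ i Y ^ (p - i)`; for `p` prime the divisions
`(p choose i) / p` are exact. -/
class DeltaRing (p : ℕ) (A : Type u) [CommRing A] where
  delta : A → A
  delta_one : delta 1 = 0
  delta_mul : ∀ x y : A,
    delta (x * y) = x ^ p * delta y + delta x * y ^ p + (p : A) * delta x * delta y
  delta_add : ∀ x y : A,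
    delta (x + y) = delta x + delta y
      - ∑ i ∈ Finset.Ioo 0 p, ((p.choose i / p : ℕ) : A) * x ^ i * y ^ (p - i)

namespace DeltaRing

theorem p_mul_sum (p : ℕ) [hp : Fact p.Prime] {A : Type u} [CommRing A] (x y : A) :
    (p : A) * ∑ i ∈ Finset.Ioo 0 p, ((p.choose i / p : ℕ) : A) * x ^ i * y ^ (p - i)
      = (x + y) ^ p - x ^ p - y ^ p := by
  have hpos : 0 < p := hp.out.pos
  have h1 : (p : A) * ∑ i ∈ Finset.Ioo 0 p, ((p.choose i / p : ℕ) : A) * x ^ i * y ^ (p - i)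
      = ∑ i ∈ Finset.Ioo 0 p, x ^ i * y ^ (p - i) * (p.choose i : A) := by
    rw [Finset.mul_sum]
    refine Finset.sum_congr rfl fun i hi => ?_
    rw [Finset.mem_Ioo] at hi
    have hd : p ∣ p.choose i := hp.out.dvd_choose_self hi.1.ne' hi.2
    have h2 : (p.choose i : A) = (p : A) * ((p.choose i / p : ℕ) : A) := by
      rw [← Nat.cast_mul, Nat.mul_div_cancel' hd]
    rw [h2]
    ring
  have h3 : Finset.range p = insert 0 (Finset.Ioo 0 p) := by
    ext i
    simp only [Finset.mem_range, Finset.mem_insert, Finset.mem_Ioo]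
    omega
  rw [h1, add_pow, Finset.sum_range_succ, h3, Finset.sum_insert (by simp)]
  simp

theorem delta_zero (p : ℕ) (A : Type u) [CommRing A] [DeltaRing p A] :
    delta p (0 : A) = 0 := by
  have h := delta_add (p := p) (0 : A) 0
  have h2 : ∑ i ∈ Finset.Ioo 0 p, ((p.choose i / p : ℕ) : A) * (0 : A) ^ i * 0 ^ (p - i) = 0 := by
    refine Finset.sum_eq_zero fun i hi => ?_
    rw [Finset.mem_Ioo] at hi
    rw [zero_pow hi.1.ne']
    simp
  rw [h2] at h
  simpa using h

/-- The Frobenius lift `φ(x) = x ^ p + p δ(x)` of a `δ`-ring, as a ring homomorphism. -/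
def frobeniusLift (p : ℕ) [hp : Fact p.Prime] (A : Type u) [CommRing A] [DeltaRing p A] :
    A →+* A where
  toFun x := x ^ p + (p : A) * delta p x
  map_one' := by simp [delta_one]
  map_mul' x y := by
    rw [delta_mul]
    ring
  map_zero' := by simp [delta_zero, hp.out.ne_zero]
  map_add' x y := by
    rw [delta_add, mul_sub, p_mul_sum]
    ring

/-- On a `p`-torsion-free ring `A`, a ring endomorphism `φ` with `φ(x) ≡ x ^ p` modulo `p`
determines a `δ`-structure, namely `δ(x) = (φ(x) - x ^ p) / p`. -/
@[reducible]
noncomputable def ofFrobeniusLift (p : ℕ) [hp : Fact p.Prime] (A : Type u) [CommRing A]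
    (htf : ∀ x : A, (p : A) * x = 0 → x = 0) (φ : A →+* A)
    (hφ : ∀ x : A, ∃ y : A, φ x = x ^ p + (p : A) * y) : DeltaRing p A :=
  have hinj : ∀ x y : A, (p : A) * x = (p : A) * y → x = y := fun x y h =>
    sub_eq_zero.mp (htf _ (by rw [mul_sub, h, sub_self]))
  have hd : ∀ x : A, (p : A) * (hφ x).choose = φ x - x ^ p := fun x =>
    eq_sub_of_add_eq' (hφ x).choose_spec.symm
  { delta := fun x => (hφ x).choose
    delta_one := hinj _ _ (by rw [hd]; simp)
    delta_mul := fun x y => hinj _ _ (by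
      have e : (p : A) * (x ^ p * (hφ y).choose + (hφ x).choose * y ^ p
          + (p : A) * (hφ x).choose * (hφ y).choose)
          = x ^ p * ((p : A) * (hφ y).choose) + ((p : A) * (hφ x).choose) * y ^ p
            + ((p : A) * (hφ x).choose) * ((p : A) * (hφ y).choose) := by ring
      rw [e, hd, hd, hd, map_mul]
      ring)
    delta_add := fun x y => hinj _ _ (by
      rw [mul_sub, mul_add, hd, hd, hd, p_mul_sum, map_add]
      ring) }

end DeltaRing

/-- A perfect `𝔽_p`-algebra: the Frobenius `a ↦ a ^ p` is bijective. (The zero ring is allowed,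
unlike with `CharP R p`.) -/
class IsPerfectFpAlgebra (p : ℕ) (R : Type u) [CommRing R] [Algebra (ZMod p) R] : Prop where
  bijective_pow : Function.Bijective fun a : R => a ^ p

/-- A `p`-Boolean algebra: an `𝔽_p`-algebra with `a ^ p = a` for all `a`. -/
class IsPBoolean (p : ℕ) (R : Type u) [CommRing R] [Algebra (ZMod p) R] : Prop where
  pow_eq_self : ∀ a : R, a ^ p = a

instance IsPBoolean.isPerfectFpAlgebra (p : ℕ) (R : Type u) [CommRing R] [Algebra (ZMod p) R]
    [IsPBoolean p R] : IsPerfectFpAlgebra p R where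
  bijective_pow := by
    have h : (fun a : R => a ^ p) = id := funext fun a => IsPBoolean.pow_eq_self a
    rw [h]
    exact Function.bijective_id

namespace WittVector

theorem eq_zero_of_p_mul_of_perfect (p : ℕ) [Fact p.Prime] (R : Type u) [CommRing R]
    [Algebra (ZMod p) R] [IsPerfectFpAlgebra p R] (x : WittVector p R)
    (h : (p : WittVector p R) * x = 0) : x = 0 := by
  cases subsingleton_or_nontrivial R with
  | inl hs => exact WittVector.ext fun n => Subsingleton.elim _ _
  | inr hn =>
    have : CharP R p := charP_of_injective_algebraMap (algebraMap (ZMod p) R).injective p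
    have : PerfectRing R p := ⟨IsPerfectFpAlgebra.bijective_pow⟩
    exact eq_zero_of_p_mul_eq_zero x (by rw [mul_comm]; exact h)

theorem exists_frobenius_eq_of_perfect (p : ℕ) [Fact p.Prime] (R : Type u) [CommRing R]
    [Algebra (ZMod p) R] [IsPerfectFpAlgebra p R] (x : WittVector p R) :
    ∃ y : WittVector p R, frobenius x = x ^ p + (p : WittVector p R) * y := by
  cases subsingleton_or_nontrivial R with
  | inl hs => exact ⟨0, WittVector.ext fun n => Subsingleton.elim _ _⟩
  | inr hn =>
    have : CharP R p := charP_of_injective_algebraMap (algebraMap (ZMod p) R).injective p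
    have : PerfectRing R p := ⟨IsPerfectFpAlgebra.bijective_pow⟩
    have h : frobenius x - x ^ p ∈ Ideal.span {(p : WittVector p R)} := by
      rw [mem_span_p_iff_coeff_zero_eq_zero]
      change constantCoeff (frobenius x - x ^ p) = 0
      rw [map_sub, map_pow]
      change (frobenius x).coeff 0 - x.coeff 0 ^ p = 0
      rw [coeff_frobenius_charP, sub_self]
    obtain ⟨y, hy⟩ := Ideal.mem_span_singleton'.mp h
    exact ⟨y, by rw [mul_comm, hy]; ring⟩

/-- The canonical `δ`-structure on the `p`-typical Witt vectors of a perfect `𝔽_p`-algebra: the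
unique one whose Frobenius lift is the Witt vector Frobenius. -/
noncomputable instance instDeltaRing (p : ℕ) [Fact p.Prime] (R : Type u) [CommRing R]
    [Algebra (ZMod p) R] [IsPerfectFpAlgebra p R] : DeltaRing p (WittVector p R) :=
  DeltaRing.ofFrobeniusLift p (WittVector p R) (eq_zero_of_p_mul_of_perfect p R) frobenius
    (exists_frobenius_eq_of_perfect p R)

/-- The Frobenius lift of the `δ`-ring of Witt vectors is the Witt vector Frobenius. -/
theorem frobeniusLift_eq_frobenius (p : ℕ) [Fact p.Prime] (R : Type u) [CommRing R]
    [Algebra (ZMod p) R] [IsPerfectFpAlgebra p R] :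
    DeltaRing.frobeniusLift p (WittVector p R) = frobenius :=
  RingHom.ext fun x => (exists_frobenius_eq_of_perfect p R x).choose_spec.symm

end WittVector

/-- A `δ`-ring isomorphism: a ring isomorphism that commutes with `δ`. -/
structure DeltaRingEquiv (p : ℕ) (A B : Type u) [CommRing A] [CommRing B] [DeltaRing p A]
    [DeltaRing p B] extends A ≃+* B where
  map_delta : ∀ a : A, toFun (DeltaRing.delta p a) = DeltaRing.delta p (toFun a)

/-- `A` is a Stone `δ`-ring: it lies in the essential image of the Witt vector functor from
`p`-Boolean algebras to `δ`-rings, i.e. it is isomorphic, as a `δ`-ring, to `W(R)` for some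
`p`-Boolean algebra `R`. -/
def IsStoneDeltaRing (p : ℕ) [Fact p.Prime] (A : Type u) [CommRing A] [DeltaRing p A] : Prop :=
  ∃ (R : Type u) (_ : CommRing R) (_ : Algebra (ZMod p) R) (_ : IsPBoolean p R),
    Nonempty (DeltaRingEquiv p A (WittVector p R))

/-! On `W(R)` with `R` `p`-Boolean, Frobenius raises coordinates to the `p`-th power, so it is the
identity, and this transports along δ-isomorphisms. Conversely, φ = id reads x = x^p + pδ(x): thus
A/p is `p`-Boolean, and A is `p`-torsion-free because δ(p) = 1 - p^(p-1). Ghost components modulo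
powers of p then assemble into a ring map W(A/p) → A that reduces to the zeroth coordinate modulo p;
torsion-freeness and completeness make it bijective. Compatibility with δ is automatic, since φ
determines δ in the absence of `p`-torsion. -/

/-- The value is tracked in ℤ, where p can be cancelled; A may still have `p`-torsion. -/
theorem DeltaRing.exists_delta_natCast (p : ℕ) [Fact p.Prime] (A : Type u) [CommRing A]
    [DeltaRing p A] (n : ℕ) :
    ∃ d : ℤ, DeltaRing.delta p (n : A) = (d : A) ∧ (p : ℤ) * d = n - (n : ℤ) ^ p := by
  induction n with
  | zero => exact ⟨0, by simp [DeltaRing.delta_zero], by simp [(Fact.out : p.Prime).ne_zero]⟩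
  | succ n ih =>
    obtain ⟨d, hd, hpd⟩ := ih
    refine ⟨d - ∑ i ∈ Finset.Ioo 0 p, ((p.choose i / p : ℕ) : ℤ) * (n : ℤ) ^ i * 1 ^ (p - i),
      ?_, ?_⟩
    · rw [Nat.cast_succ, DeltaRing.delta_add, hd, DeltaRing.delta_one, add_zero, Int.cast_sub,
        Int.cast_sum]
      simp only [Int.cast_mul, Int.cast_pow, Int.cast_natCast, Int.cast_one]
    · rw [mul_sub, DeltaRing.p_mul_sum, hpd]
      push_cast
      ring

theorem DeltaRing.delta_natCast_self (p : ℕ) [hp : Fact p.Prime] (A : Type u) [CommRing A]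
    [DeltaRing p A] : DeltaRing.delta p (p : A) = 1 - (p : A) ^ (p - 1) := by
  obtain ⟨d, hd, hpd⟩ := DeltaRing.exists_delta_natCast p A p
  have hp0 : (p : ℤ) ≠ 0 := by exact_mod_cast hp.out.ne_zero
  have h : d = 1 - (p : ℤ) ^ (p - 1) := by
    apply mul_left_cancel₀ hp0
    rw [hpd, mul_sub, mul_pow_sub_one hp.out.ne_zero, mul_one]
  rw [hd, h]
  push_cast
  rfl

theorem DeltaRing.eq_pow_add_of_frobeniusLift_eq_id {p : ℕ} [Fact p.Prime] {A : Type u}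
    [CommRing A] [DeltaRing p A] (h : DeltaRing.frobeniusLift p A = RingHom.id A) (x : A) :
    x ^ p + (p : A) * DeltaRing.delta p x = x :=
  RingHom.congr_fun h x

/-- A `δ`-ring whose Frobenius lift is the identity is `p`-torsion-free. -/
theorem DeltaRing.eq_zero_of_p_mul_of_frobeniusLift_eq_id {p : ℕ} [hp : Fact p.Prime] {A : Type u}
    [CommRing A] [DeltaRing p A] (h : DeltaRing.frobeniusLift p A = RingHom.id A) (x : A)
    (hx : (p : A) * x = 0) : x = 0 := by
  have hφ := DeltaRing.eq_pow_add_of_frobeniusLift_eq_id h x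
  -- Expanding δ(px) = 0 gives p^p δ(x) + δ(p)φ(x) = 0, with φ(x) = x. Both p^(p-1) x and p²δ(x) =
  -- p(x - x^p) vanish, leaving x = 0.
  have h1 := DeltaRing.delta_mul (p := p) (p : A) x
  rw [hx, DeltaRing.delta_zero, DeltaRing.delta_natCast_self] at h1
  obtain ⟨k, hk⟩ : ∃ k, p = k + 2 := Nat.exists_eq_add_of_le' hp.out.two_le
  have e1 : (p : A) ^ (p - 1) = (p : A) ^ k * p := by
    rw [← pow_succ, show p - 1 = k + 1 by omega]
  have e2 : (p : A) ^ p = (p : A) ^ k * p * p := by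
    rw [← pow_succ, ← pow_succ, show k + 1 + 1 = p by omega]
  have e3 : x ^ p = x ^ (k + 1) * x := by
    rw [← pow_succ, show k + 1 + 1 = p by omega]
  rw [e1, e2] at h1
  have h2 : (p : A) * ((p : A) * DeltaRing.delta p x) = 0 := by
    linear_combination (p : A) * hφ + hx - (p : A) * e3 - x ^ (k + 1) * hx
  linear_combination -h1 - (p : A) ^ k * h2 - (1 - (p : A) ^ k * p) * hφ + (p : A) ^ k * hx

namespace WittVector

theorem frobenius_eq_id_of_isPBoolean (p : ℕ) [Fact p.Prime] (R : Type u) [CommRing R]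
    [Algebra (ZMod p) R] [IsPBoolean p R] :
    (frobenius : WittVector p R →+* WittVector p R) = RingHom.id _ := by
  cases subsingleton_or_nontrivial R with
  | inl hs => exact RingHom.ext fun x => WittVector.ext fun n => Subsingleton.elim _ _
  | inr hn =>
    have : CharP R p := charP_of_injective_algebraMap (algebraMap (ZMod p) R).injective p
    ext x n
    rw [coeff_frobenius_charP, IsPBoolean.pow_eq_self, RingHom.id_apply]

section PBooleanQuotient

open Ideal Ideal.Quotient IsAdicComplete

variable {p : ℕ} [Fact p.Prime] {A : Type u} [CommRing A]

theorem ghostComponentModPPow_teichmuller (n : ℕ) (a : A) :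
    ghostComponentModPPow n (teichmuller p (Ideal.Quotient.mk (span {(p : A)}) a))
      = Ideal.Quotient.mk (span {(p : A)} ^ (n + 1)) (a ^ p ^ n) := by
  rw [← map_teichmuller, ghostComponentModPPow_map_mk, ghostComponent_teichmuller]

/-- Ring maps out of Witt vectors of a perfect ring into a ring where p is nilpotent are determined
by Teichmüller lifts. There a ↦ a^(p^n), and the lower level may use the representative a^p instead
of a. -/
theorem factorPowSucc_comp_ghostComponentModPPow (h : ∀ a : A ⧸ span {(p : A)}, a ^ p = a)
    [CharP (A ⧸ span {(p : A)}) p] [PerfectRing (A ⧸ span {(p : A)}) p] (n : ℕ) :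
    (factorPowSucc (span {(p : A)}) (n + 1)).comp (ghostComponentModPPow (n + 1))
      = ghostComponentModPPow (p := p) n := by
  apply eq_of_apply_teichmuller_eq
  · use n + 1
    rw [← map_natCast (Ideal.Quotient.mk (span {(p : A)} ^ (n + 1))), ← map_pow,
      Ideal.Quotient.eq_zero_iff_mem]
    exact Ideal.pow_mem_pow (mem_span_singleton_self _) _
  · intro x
    obtain ⟨a, rfl⟩ := Ideal.Quotient.mk_surjective x
    have ha : Ideal.Quotient.mk (span {(p : A)}) a = Ideal.Quotient.mk _ (a ^ p) := by
      rw [map_pow, h]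
    rw [RingHom.comp_apply, ghostComponentModPPow_teichmuller, ha,
      ghostComponentModPPow_teichmuller, ← pow_mul, ← pow_succ']
    rfl

theorem exists_ringEquiv_of_quotient_pow_eq_self [IsAdicComplete (span {(p : A)}) A]
    (htf : ∀ x : A, (p : A) * x = 0 → x = 0) (h : ∀ a : A ⧸ span {(p : A)}, a ^ p = a)
    [CharP (A ⧸ span {(p : A)}) p] [PerfectRing (A ⧸ span {(p : A)}) p] :
    Nonempty (WittVector p (A ⧸ span {(p : A)}) ≃+* A) := by
  -- The n-th ghost component lands in A/p^(n+1), hence the successor as index sequence.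
  let θ : WittVector p (A ⧸ span {(p : A)}) →+* A :=
    Order.succ_strictMono.liftRingHom (span {(p : A)}) ghostComponentModPPow
      (factorPowSucc_comp_ghostComponentModPPow h _)
  have hθ (x : WittVector p (A ⧸ span {(p : A)})) :
      Ideal.Quotient.mk (span {(p : A)}) (θ x) = x.coeff 0 := by
    have h0 : Ideal.Quotient.mk (span {(p : A)} ^ (0 + 1)) (θ x) = ghostComponentModPPow 0 x :=
      Order.succ_strictMono.mk_liftRingHom (span {(p : A)}) ghostComponentModPPow
      (factorPowSucc_comp_ghostComponentModPPow h _) (n := 0) x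
    have h1 := congrArg (Ideal.quotEquivOfEq (show span {(p : A)} ^ (0 + 1) = span {(p : A)} by
      simp)) h0
    rw [quotEquivOfEq_ghostComponentModPPow] at h1
    simpa [ghostComponent_apply] using h1
  refine ⟨RingEquiv.ofBijective θ ⟨?_, ?_⟩⟩
  · rw [injective_iff_map_eq_zero]
    -- A kernel element has zeroth coordinate 0, so it is py, and y is again in the kernel because A
    -- is `p`-torsion-free.
    have key (n : ℕ) : ∀ x, θ x = 0 → (p : WittVector p (A ⧸ span {(p : A)})) ^ n ∣ x := by
      induction n with
      | zero => simp
      | succ n ih =>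
        intro x hx
        have hx0 : x.coeff 0 = 0 := by rw [← hθ, hx, map_zero]
        obtain ⟨y, rfl⟩ := Ideal.mem_span_singleton.mp
          ((mem_span_p_iff_coeff_zero_eq_zero x).mpr hx0)
        rw [map_mul, map_natCast] at hx
        rw [pow_succ']
        exact mul_dvd_mul_left _ (ih y (htf _ hx))
    intro x hx
    ext n
    rw [zero_coeff]
    exact (mem_span_p_pow_iff_le_coeff_eq_zero x (n + 1)).mp
      (Ideal.mem_span_singleton.mpr (key (n + 1) x hx)) n n.lt_succ_self
  · have hmap : (span {(p : WittVector p (A ⧸ span {(p : A)}))}).map θ = span {(p : A)} := by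
      simp [map_span]
    have : IsHausdorff ((span {(p : WittVector p (A ⧸ span {(p : A)}))}).map θ) A := by
      rw [hmap]
      infer_instance
    -- By `p`-adic completeness of the Witt vectors and separatedness of A, surjectivity modulo p
    -- suffices.
    apply surjective_of_mk_map_comp_surjective θ
      (I := span {(p : WittVector p (A ⧸ span {(p : A)}))})
    rw [hmap]
    intro b
    refine ⟨teichmuller p b, ?_⟩
    simp [hθ]

end PBooleanQuotient

end WittVector

theorem frobeniusLift_eq_id_of_isStoneDeltaRing {p : ℕ} [Fact p.Prime] {A : Type u} [CommRing A]
    [DeltaRing p A] (h : IsStoneDeltaRing p A) :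
    DeltaRing.frobeniusLift p A = RingHom.id A := by
  obtain ⟨R, _, _, _, ⟨e⟩⟩ := h
  ext a
  apply e.toRingEquiv.injective
  have h1 := RingHom.congr_fun ((WittVector.frobeniusLift_eq_frobenius p R).trans
    (WittVector.frobenius_eq_id_of_isPBoolean p R)) (e.toRingEquiv a)
  have h2 : e.toRingEquiv (DeltaRing.delta p a) = DeltaRing.delta p (e.toRingEquiv a) :=
    e.map_delta a
  change e.toRingEquiv (a ^ p + (p : A) * DeltaRing.delta p a) = e.toRingEquiv a
  rw [map_add, map_mul, map_pow, map_natCast, h2]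
  exact h1

/-- A ring isomorphism between `δ`-rings whose Frobenius lifts are the identity commutes
with `δ`. -/
def DeltaRingEquiv.ofRingEquiv {p : ℕ} [Fact p.Prime] {A B : Type u} [CommRing A] [CommRing B]
    [DeltaRing p A] [DeltaRing p B] (hA : DeltaRing.frobeniusLift p A = RingHom.id A)
    (hB : DeltaRing.frobeniusLift p B = RingHom.id B) (e : A ≃+* B) : DeltaRingEquiv p A B where
  toRingEquiv := e
  map_delta a := by
    change e (DeltaRing.delta p a) = DeltaRing.delta p (e a)
    -- After multiplication by p, both sides become e(a) - e(a)^p.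
    refine sub_eq_zero.mp (DeltaRing.eq_zero_of_p_mul_of_frobeniusLift_eq_id hB _ ?_)
    have h1 := congrArg e (DeltaRing.eq_pow_add_of_frobeniusLift_eq_id hA a)
    rw [map_add, map_mul, map_pow, map_natCast] at h1
    linear_combination h1 - DeltaRing.eq_pow_add_of_frobeniusLift_eq_id hB (e a)

theorem isStoneDeltaRing_of_frobeniusLift_eq_id {p : ℕ} [hp : Fact p.Prime] {A : Type u}
    [CommRing A] [DeltaRing p A] [IsAdicComplete (Ideal.span {(p : A)}) A]
    (h : DeltaRing.frobeniusLift p A = RingHom.id A) : IsStoneDeltaRing p A := by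
  have hpow (a : A ⧸ Ideal.span {(p : A)}) : a ^ p = a := by
    obtain ⟨x, rfl⟩ := Ideal.Quotient.mk_surjective a
    rw [← map_pow, Ideal.Quotient.eq, Ideal.mem_span_singleton]
    exact ⟨-DeltaRing.delta p x, by
      linear_combination DeltaRing.eq_pow_add_of_frobeniusLift_eq_id h x⟩
  suffices H : ∃ _ : Algebra (ZMod p) (A ⧸ Ideal.span {(p : A)}),
      Nonempty (A ≃+* WittVector p (A ⧸ Ideal.span {(p : A)})) by
    obtain ⟨_, ⟨e⟩⟩ := H
    have : IsPBoolean p (A ⧸ Ideal.span {(p : A)}) := ⟨hpow⟩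
    exact ⟨_, inferInstance, inferInstance, this, ⟨DeltaRingEquiv.ofRingEquiv h
      ((WittVector.frobeniusLift_eq_frobenius p _).trans
        (WittVector.frobenius_eq_id_of_isPBoolean p _)) e⟩⟩
  cases subsingleton_or_nontrivial (A ⧸ Ideal.span {(p : A)}) with
  | inl hs =>
    -- If A = pA, separatedness forces A = 0.
    have hA : Subsingleton A := by
      rw [Ideal.Quotient.subsingleton_iff] at hs
      have hH : IsHausdorff (⊤ : Ideal A) A := hs ▸ inferInstance
      exact hH.subsingleton
    -- The zero ring has characteristic 1, not p; its 𝔽_p-algebra structure comes from 1 ∣ p.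
    have : CharP (A ⧸ Ideal.span {(p : A)}) 1 := ⟨fun n => by simp [Subsingleton.elim (n : A ⧸ Ideal.span {(p : A)}) 0]⟩
    have hW : Subsingleton (WittVector p (A ⧸ Ideal.span {(p : A)})) :=
      ⟨fun x y => WittVector.ext fun n => Subsingleton.elim _ _⟩
    exact ⟨ZMod.algebra' _ 1 (one_dvd p), ⟨{
      toFun := 0
      invFun := 0
      left_inv := fun _ => Subsingleton.elim _ _
      right_inv := fun _ => Subsingleton.elim _ _
      map_mul' := fun _ _ => Subsingleton.elim _ _
      map_add' := fun _ _ => Subsingleton.elim _ _ }⟩⟩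
  | inr hn =>
    have hp0 : ((p : ℕ) : A ⧸ Ideal.span {(p : A)}) = 0 := by
      rw [← map_natCast (Ideal.Quotient.mk _), Ideal.Quotient.eq_zero_iff_mem]
      exact Ideal.mem_span_singleton_self _
    have : CharP (A ⧸ Ideal.span {(p : A)}) p :=
      (CharP.charP_iff_prime_eq_zero hp.out).mpr hp0
    have : PerfectRing (A ⧸ Ideal.span {(p : A)}) p := ⟨by
      convert Function.bijective_id using 1
      exact funext hpow⟩
    obtain ⟨e⟩ := WittVector.exists_ringEquiv_of_quotient_pow_eq_self
      (DeltaRing.eq_zero_of_p_mul_of_frobeniusLift_eq_id h) hpow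
    exact ⟨ZMod.algebra _ p, ⟨e.symm⟩⟩

theorem mainTheorem4 (p : ℕ) [Fact p.Prime] (A : Type u) [CommRing A] [DeltaRing p A]
    [IsAdicComplete (Ideal.span {(p : A)}) A] :
    IsStoneDeltaRing p A ↔ DeltaRing.frobeniusLift p A = RingHom.id A :=
  ⟨frobeniusLift_eq_id_of_isStoneDeltaRing, isStoneDeltaRing_of_frobeniusLift_eq_id⟩
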